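/- Let $d\ge 2$ be an integer and let $L^2_{r^{d-1}}([0,1])$ be the Hilbert space of (classes of) measurable functions $g\colon[0,1]\to\mathbb{C}$ with $\int_0^1|g(r)|^2r^{d-1}\,dr<\infty$. For integers $\ell,k\ge 0$ consider $$R_{\ell,k}(r)=C_{\ell,k}\,r^{\ell}\,{}_2F_1\bigl(-k,\ \ell+k+\tfrac d2;\ \ell+\tfrac d2;\ r^2\bigr),$$ where the constant $C_{\ell,k}\in\mathbb{R}$ is normalizing, i.e. $\int_0^1 R_{\ell,k}(r)^2\,r^{d-1}\,dr=1$ (since the hypergeometric series terminates, $R_{\ell,k}$ is a polynomial, a $d$-dimensional radial Zernike polynomial). For real $x$ and an integer $k\ge0$ write $\binom xk=\frac{x(x-1)\cdots(x-k+1)}{k!}$. Such constants exist and can be chosen with $R_{\ell,k}(1)>0$ for all $\ell,k\ge0$, and the following hold for every choice of normalizing constants, where in (ii), in the first statement of (iii), and in (v) the sign of each $C_{\ell,k}$ involved is chosen such that $R_{\ell,k}(1)>0$. (i) For each $\ell\ge 0$, $\{R_{\ell,k}\}_{k\ge 0}$ is an orthonormal basis of $L^2_{r^{d-1}}([0,1])$.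 (ii) For all $\ell,k\ge0$, $$C_{\ell,k}=(-1)^k\sqrt{2\ell+4k+d}\,\binom{\ell+k+\frac{d-2}{2}}{k},\qquad R_{\ell,k}(1)=\sqrt{2\ell+4k+d}.$$ (iii) $R_{\ell,k}'(1)>0$ for all $(\ell,k)\neq(0,0)$. The function $R_{0,0}$ is constant. (iv) For all $\ell,k\ge0$, $\displaystyle\max_{r\in[0,1]}|R_{\ell,k}(r)|\le |C_{\ell,k}|$. (v) For all $\ell,p\ge0$ and all $r$, $$r^{\ell+2p}=\sum_{k=0}^{p}\chi_{\ell,k,p}\,R_{\ell,k}(r),\qquad \chi_{\ell,k,p}=\frac{\sqrt{2\ell+4k+d}}{2p+2\ell+2k+d}\binom pk\binom{p+\ell+k+\frac{d-2}{2}}{k}^{-1}.$$ -/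

import Mathlib

open MeasureTheory

noncomputable section

/-- The radial function `r ↦ c · r ^ ℓ · ₂F₁(-k, ℓ + k + d/2; ℓ + d/2; r ^ 2)` in dimension `d`
with prefactor `c`. The hypergeometric series terminates because `-k` is a nonpositive integer;
`c` is fixed up to sign by `IsNormalizing`. -/
def radialZernike (d ℓ k : ℕ) (c : ℝ) (r : ℝ) : ℝ :=
  c * r ^ ℓ *
    ordinaryHypergeometric (-(k : ℝ)) ((ℓ : ℝ) + k + (d : ℝ) / 2) ((ℓ : ℝ) + (d : ℝ) / 2) (r ^ 2)

/-- `c` is a normalization constant: the function `radialZernike d ℓ k c` has unit norm with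
respect to the weight `r ^ (d - 1)` on `[0, 1]`. -/
def IsNormalizing (d ℓ k : ℕ) (c : ℝ) : Prop :=
  ∫ r in (0 : ℝ)..1, radialZernike d ℓ k c r ^ 2 * r ^ (d - 1) = 1

/-- The measure `r ^ (d - 1) dr` on `[0, 1]`. -/
def radialMeasure (d : ℕ) : Measure ℝ :=
  (volume.restrict (Set.Icc (0 : ℝ) 1)).withDensity (fun r => ENNReal.ofReal (r ^ (d - 1)))

/-- The functions `f k : ℝ → ℝ` (more precisely, their classes) form an orthonormal (Hilbert)
basis of the complex Hilbert space `L²([0, 1], r ^ (d - 1) dr)`. -/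
def IsRadialOrthonormalBasis (d : ℕ) (f : ℕ → ℝ → ℝ) : Prop :=
  ∃ b : HilbertBasis ℕ ℂ (Lp ℂ 2 (radialMeasure d)),
    ∀ k, (b k : ℝ → ℂ) =ᵐ[radialMeasure d] fun r => (f k r : ℂ)

/-- The closed form `(-1)^k √(2ℓ + 4k + d) · binom(ℓ + k + (d - 2)/2, k)`, with the generalized
binomial coefficient `binom(x, k) = x (x - 1) ⋯ (x - k + 1) / k!`. -/
def zernikeConst (d ℓ k : ℕ) : ℝ :=
  (-1) ^ k * √(2 * (ℓ : ℝ) + 4 * k + d) * Ring.choose ((ℓ : ℝ) + k + ((d : ℝ) - 2) / 2) k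

/-- The coefficient of the `k`-th radial Zernike polynomial in the expansion of
`r ^ (ℓ + 2 p)`. -/
def zernikeChi (d ℓ k p : ℕ) : ℝ :=
  √(2 * (ℓ : ℝ) + 4 * k + d) / (2 * (p : ℝ) + 2 * ℓ + 2 * k + d) * (p.choose k : ℝ) *
    (Ring.choose ((p : ℝ) + ℓ + k + ((d : ℝ) - 2) / 2) k)⁻¹

end

/-! With `b = ℓ + d/2` and `x = r ^ 2`, everything reduces to the polynomial `F = ₂F₁(-k, b + k; b;
x)`. Its coefficients are, up to the factor `F(1)`, the Lagrange weights of `P = ∏_{i<k} (X - (b +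
i))` at the nodes `0, -1, …, -k`. Comparing leading coefficients gives `F(1)`; evaluating the
interpolation at `s > 0` gives `∑ a_j / (s + j) = F(1) P(s) / (s)_{k+1}`
(`sum_terminatingCoeff_div`). At `s = b + p` this is twice the `p`-th weighted moment of `F`, with a
factor `p(p-1)⋯(p-k+1)` that vanishes for `p < k`. Orthogonality, the norm, the constants and the
expansion of `r ^ (ℓ + 2p)` follow.

The hypergeometric equation at `x = 1` gives `F'(1)`, and its Sonin function gives `|F| ≤ 1` on `[0,
1]`. For completeness, a function orthogonal to all `R_{ℓ,k}` has, after multiplication by `r ^ ℓ`,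
vanishing even moments, so it is zero by Weierstrass approximation in `r ^ 2`. -/

/-! ### Factorial and Pochhammer identities -/

open Polynomial Finset in
theorem prod_erase_range_natCast_sub (j n : ℕ) :
    ∏ m ∈ (range (j + n + 1)).erase j, ((m : ℝ) - j) = (-1) ^ j * j.factorial * n.factorial := by
  induction n with
  | zero =>
    have h : (range (j + 0 + 1)).erase j = range j := by ext; simp; omega
    rw [h, ← prod_range_reflect, ← prod_range_add_one_eq_factorial]
    push_cast
    rw [Nat.factorial_zero, Nat.cast_one, mul_one]
    have h2 : (-1 : ℝ) ^ j = ∏ i ∈ range j, (-1 : ℝ) := by simp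
    rw [h2, ← prod_mul_distrib]
    refine prod_congr rfl fun i hi => ?_
    have : i + 1 ≤ j := mem_range.1 hi
    rw [Nat.sub_sub, Nat.cast_sub (by omega)]
    push_cast
    ring
  | succ n ih =>
    have h : (range (j + (n + 1) + 1)).erase j
        = insert (j + n + 1) ((range (j + n + 1)).erase j) := by ext; simp; omega
    rw [h, prod_insert (by simp), ih, Nat.factorial_succ]
    push_cast
    ring

open Polynomial Finset in
theorem ascPochhammer_eval_eq_prod_range (n : ℕ) (x : ℝ) :
    (ascPochhammer ℝ n).eval x = ∏ i ∈ range n, (x + i) := by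
  induction n with
  | zero => simp
  | succ n ih => rw [ascPochhammer_succ_eval, ih, prod_range_succ]

open Polynomial Finset in
theorem ascPochhammer_eval_add (m n : ℕ) (x : ℝ) :
    (ascPochhammer ℝ (m + n)).eval x =
      (ascPochhammer ℝ m).eval x * (ascPochhammer ℝ n).eval (x + m) := by
  rw [← ascPochhammer_mul]
  simp

open Polynomial Finset in
theorem ascPochhammer_eval_neg_natCast {j k : ℕ} (h : j ≤ k) :
    (ascPochhammer ℝ j).eval (-(k : ℝ)) * (k - j).factorial = (-1) ^ j * k.factorial := by
  induction j with
  | zero => simp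
  | succ j ih =>
    have h1 : k - j = (k - (j + 1)) + 1 := by omega
    have h2 := ih (by omega)
    rw [h1, Nat.factorial_succ] at h2
    have h3 : ((k - (j + 1) : ℕ) : ℝ) = k - (j + 1) := by
      rw [Nat.cast_sub h]; push_cast; ring
    push_cast at h2
    rw [h3] at h2
    rw [ascPochhammer_succ_eval, pow_succ, mul_assoc _ (-1 : ℝ), mul_left_comm, mul_comm _ (_ * _),
      mul_assoc]
    linear_combination (-1 : ℝ) * h2

/-! ### The terminating hypergeometric polynomial -/

/-- The coefficient of `x ^ j` in `₂F₁(-k, b + k; b; x)`. -/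
noncomputable def terminatingCoeff (b : ℝ) (k j : ℕ) : ℝ :=
  ordinaryHypergeometricCoefficient (-(k : ℝ)) (b + k) b j

/-- The value of `₂F₁(-k, b + k; b; x)` at `x = 1`. -/
noncomputable def terminatingEndpoint (b : ℝ) (k : ℕ) : ℝ :=
  (-1) ^ k * k.factorial / (ascPochhammer ℝ k).eval b

/-- The terminating hypergeometric series `₂F₁(-k, b + k; b; x)` as a polynomial. -/
noncomputable def terminatingPoly (b : ℝ) (k : ℕ) : Polynomial ℝ :=
  ∑ j ∈ Finset.range (k + 1), Polynomial.monomial j (terminatingCoeff b k j)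

open Polynomial Finset in
theorem terminatingCoeff_eq_zero {b : ℝ} {k j : ℕ} (h : k < j) : terminatingCoeff b k j = 0 := by
  simp [terminatingCoeff, ascPochhammer_eval_neg_coe_nat_of_lt h]

open Polynomial Finset in
theorem coeff_terminatingPoly (b : ℝ) (k j : ℕ) :
    (terminatingPoly b k).coeff j = terminatingCoeff b k j := by
  simp only [terminatingPoly, finsetSum_coeff, coeff_monomial]
  rw [Finset.sum_ite_eq']
  split_ifs with h
  · rfl
  · exact (terminatingCoeff_eq_zero (by simpa using h)).symm

open Polynomial Finset in
theorem ordinaryHypergeometric_neg_natCast (b x : ℝ) (k : ℕ) :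
    ordinaryHypergeometric (-(k : ℝ)) (b + k) b x = (terminatingPoly b k).eval x := by
  rw [ordinaryHypergeometric_eq_tsum]
  simp only [smul_eq_mul]
  rw [tsum_eq_sum (s := range (k + 1)), terminatingPoly, eval_finsetSum]
  · simp [terminatingCoeff, ordinaryHypergeometricCoefficient]
  · intro j hj
    have : terminatingCoeff b k j = 0 := terminatingCoeff_eq_zero (by simpa using hj)
    simp only [terminatingCoeff, ordinaryHypergeometricCoefficient] at this
    rw [this, zero_mul]

-- Both `(b)_k (b + k)_j` and `(b)_j (b + j)_k` equal `(b)_{j+k}`. The exchange turns the dependence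
-- on `j` into a degree `k` polynomial in `j` over `± j! (k - j)!`, the shape of a Lagrange weight.
open Polynomial Finset in
theorem terminatingCoeff_eq {b : ℝ} (hb : 0 < b) {k j : ℕ} (h : j ≤ k) :
    terminatingCoeff b k j = terminatingEndpoint b k *
      ((-1) ^ k * (ascPochhammer ℝ k).eval (b + j)) *
        ((-1 : ℝ) ^ j * j.factorial * (k - j).factorial)⁻¹ := by
  have h1 := ascPochhammer_pos k b hb
  have h2 := ascPochhammer_pos j b hb
  have h3 : (ascPochhammer ℝ k).eval b * (ascPochhammer ℝ j).eval (b + k) =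
      (ascPochhammer ℝ j).eval b * (ascPochhammer ℝ k).eval (b + j) := by
    rw [← ascPochhammer_eval_add, ← ascPochhammer_eval_add, add_comm]
  have h4 := ascPochhammer_eval_neg_natCast h
  have h5 : ((k - j).factorial : ℝ) ≠ 0 := by positivity
  have h6 : (j.factorial : ℝ) ≠ 0 := by positivity
  have h7 : ((-1 : ℝ) ^ j) * (-1) ^ j = 1 := by rw [← mul_pow]; simp
  have h8 : ((-1 : ℝ) ^ k) * (-1) ^ k = 1 := by rw [← mul_pow]; simp
  have h9 : (ascPochhammer ℝ j).eval (-(k : ℝ)) = (-1) ^ j * k.factorial / (k - j).factorial := by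
    rw [← h4]; field_simp
  have h10 : (ascPochhammer ℝ j).eval (b + k) = (ascPochhammer ℝ j).eval b *
      (ascPochhammer ℝ k).eval (b + j) / (ascPochhammer ℝ k).eval b := by
    rw [← h3]; field_simp
  have h11 : ((-1 : ℝ) ^ j)⁻¹ = (-1) ^ j := inv_eq_of_mul_eq_one_left h7
  rw [terminatingCoeff, ordinaryHypergeometricCoefficient, terminatingEndpoint, h9, h10,
    mul_inv, mul_inv, h11]
  generalize (ascPochhammer ℝ k).eval (b + j) = A at *
  field_simp
  linear_combination (-A) * h8

/-! ### Lagrange interpolation at `0, -1, …, -k` -/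

open Polynomial Finset in
theorem injOn_neg_natCast (s : Set ℕ) : Set.InjOn (fun j : ℕ => -(j : ℝ)) s :=
  fun _ _ _ _ h => Nat.cast_injective (neg_injective h)

open Polynomial Finset in
theorem prod_erase_neg_natCast {k j : ℕ} (h : j ≤ k) :
    ∏ m ∈ (range (k + 1)).erase j, (-(j : ℝ) - -(m : ℝ)) =
      (-1) ^ j * j.factorial * (k - j).factorial := by
  obtain ⟨n, rfl⟩ := Nat.exists_eq_add_of_le h
  rw [Nat.add_sub_cancel_left, ← prod_erase_range_natCast_sub]
  exact prod_congr rfl fun _ _ => by ring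

/-- The monic polynomial `∏_{i < k} (X - (b + i))`. -/
noncomputable def shiftedNodal (b : ℝ) (k : ℕ) : Polynomial ℝ :=
  ∏ i ∈ Finset.range k, (Polynomial.X - Polynomial.C (b + i))

open Polynomial Finset in
theorem eval_shiftedNodal (b s : ℝ) (k : ℕ) :
    (shiftedNodal b k).eval s = ∏ i ∈ range k, (s - b - i) := by
  rw [shiftedNodal, eval_prod]
  exact prod_congr rfl fun _ _ => by simp; ring

open Polynomial Finset in
theorem eval_shiftedNodal_neg (b : ℝ) (k j : ℕ) :
    (shiftedNodal b k).eval (-(j : ℝ)) = (-1) ^ k * (ascPochhammer ℝ k).eval (b + j) := by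
  rw [eval_shiftedNodal, ascPochhammer_eval_eq_prod_range]
  have h2 : (-1 : ℝ) ^ k = ∏ i ∈ range k, (-1 : ℝ) := by simp
  rw [h2, ← prod_mul_distrib]
  exact prod_congr rfl fun _ _ => by ring

open Polynomial Finset in
theorem monic_shiftedNodal (b : ℝ) (k : ℕ) : (shiftedNodal b k).Monic :=
  monic_prod_of_monic _ _ fun _ _ => monic_X_sub_C _

open Polynomial Finset in
theorem degree_shiftedNodal (b : ℝ) (k : ℕ) : (shiftedNodal b k).degree = k := by
  rw [shiftedNodal, degree_prod]
  simp only [degree_X_sub_C]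
  simp

open Polynomial Finset in
theorem terminatingCoeff_eq_lagrange {b : ℝ} (hb : 0 < b) {k j : ℕ} (h : j ≤ k) :
    terminatingCoeff b k j = terminatingEndpoint b k *
      ((shiftedNodal b k).eval (-(j : ℝ)) /
        ∏ m ∈ (range (k + 1)).erase j, (-(j : ℝ) - -(m : ℝ))) := by
  rw [terminatingCoeff_eq hb h, eval_shiftedNodal_neg, prod_erase_neg_natCast h, mul_assoc,
    div_eq_mul_inv]

-- The weights of a degree `k` polynomial at `k + 1` nodes sum to its leading coefficient, here `1`.
open Polynomial Finset in
theorem sum_terminatingCoeff {b : ℝ} (hb : 0 < b) (k : ℕ) :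
    ∑ j ∈ range (k + 1), terminatingCoeff b k j = terminatingEndpoint b k := by
  have h := Lagrange.leadingCoeff_eq_sum (injOn_neg_natCast (range (k + 1) : Set ℕ))
    (P := shiftedNodal b k) (by simp [degree_shiftedNodal])
  rw [(monic_shiftedNodal b k).leadingCoeff] at h
  rw [sum_congr rfl fun j hj =>
    terminatingCoeff_eq_lagrange hb (Nat.lt_succ_iff.1 (mem_range.1 hj)), ← mul_sum, ← h, mul_one]

open Polynomial Finset in
theorem eval_one_terminatingPoly {b : ℝ} (hb : 0 < b) (k : ℕ) :
    (terminatingPoly b k).eval 1 = terminatingEndpoint b k := by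
  simp [terminatingPoly, eval_finsetSum, sum_terminatingCoeff hb]

-- This is the partial fraction decomposition of `P(s) / (s)_{k+1}`, whose poles are the nodes.
open Polynomial Finset in
theorem sum_terminatingCoeff_div {b s : ℝ} (hb : 0 < b) (hs : 0 < s) (k : ℕ) :
    ∑ j ∈ range (k + 1), terminatingCoeff b k j / (s + j) =
      terminatingEndpoint b k * (∏ i ∈ range k, (s - b - i)) /
        (ascPochhammer ℝ (k + 1)).eval s := by
  have hinj := injOn_neg_natCast (range (k + 1) : Set ℕ)
  have h := Lagrange.eq_interpolate (s := range (k + 1)) (f := shiftedNodal b k) hinj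
    (by rw [degree_shiftedNodal, card_range]; exact_mod_cast Nat.lt_succ_self k)
  have hx : ∀ j ∈ range (k + 1), s ≠ -(j : ℝ) := fun j _ => by
    have : (0 : ℝ) ≤ j := j.cast_nonneg
    linarith
  have h2 := congrArg (eval s) h
  rw [Lagrange.eval_interpolate_not_at_node _ hx, Lagrange.eval_nodal, eval_shiftedNodal] at h2
  simp only [sub_neg_eq_add] at h2
  rw [← ascPochhammer_eval_eq_prod_range] at h2
  have hp := ascPochhammer_pos (k + 1) s hs
  rw [h2, mul_left_comm, mul_div_cancel_left₀ _ hp.ne', mul_sum]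
  refine sum_congr rfl fun j hj => ?_
  rw [terminatingCoeff_eq_lagrange hb (Nat.lt_succ_iff.1 (mem_range.1 hj)),
    Lagrange.nodalWeight, prod_inv_distrib]
  ring

open Polynomial Finset in
theorem terminatingEndpoint_ne_zero {b : ℝ} (hb : 0 < b) (k : ℕ) : terminatingEndpoint b k ≠ 0 := by
  have := ascPochhammer_pos k b hb
  unfold terminatingEndpoint
  positivity

open Polynomial Finset in
theorem terminatingCoeff_self {b : ℝ} (hb : 0 < b) (k : ℕ) :
    terminatingCoeff b k k = terminatingEndpoint b k * (ascPochhammer ℝ k).eval (b + k)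
      / k.factorial := by
  rw [terminatingCoeff_eq hb le_rfl]
  have : ((-1 : ℝ) ^ k) ≠ 0 := by positivity
  have : (k.factorial : ℝ) ≠ 0 := by positivity
  simp
  field_simp

-- Since `b ≥ 1`, each factor of `k! = ∏ (i + 1)` is at most the matching factor of `(b)_k = ∏ (b +
-- i)`.
open Polynomial Finset in
theorem abs_terminatingEndpoint_le_one {b : ℝ} (hb : 1 ≤ b) (k : ℕ) :
    |terminatingEndpoint b k| ≤ 1 := by
  have hp := ascPochhammer_pos k b (by linarith)
  rw [terminatingEndpoint, abs_div, abs_mul, abs_pow, abs_neg, abs_one, one_pow, one_mul,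
    abs_of_pos hp, Nat.abs_cast, div_le_one hp, ascPochhammer_eval_eq_prod_range,
    ← prod_range_add_one_eq_factorial]
  push_cast
  exact prod_le_prod (fun _ _ => by positivity) fun i _ => by linarith

theorem Ring.choose_eq_ascPochhammer_div (x : ℝ) (k : ℕ) :
    Ring.choose (x + k) k = (ascPochhammer ℝ k).eval (x + 1) / k.factorial := by
  have h := Ring.factorial_nsmul_multichoose_eq_ascPochhammer (x + 1) k
  rw [Ring.multichoose_eq, Polynomial.ascPochhammer_smeval_eq_eval] at h
  rw [← h, show x + 1 + k - 1 = x + k by ring, nsmul_eq_mul, mul_div_cancel_left₀]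
  positivity

/-! ### The differential equation and the Sonin bound -/

open Polynomial Finset in
theorem terminatingCoeff_succ {b : ℝ} (hb : 0 < b) (k j : ℕ) :
    ((j : ℝ) + 1) * (b + j) * terminatingCoeff b k (j + 1) =
      ((j : ℝ) - k) * (b + k + j) * terminatingCoeff b k j := by
  have h1 := ascPochhammer_pos j b hb
  have h2 : 0 < b + j := by positivity
  simp only [terminatingCoeff, ordinaryHypergeometricCoefficient, ascPochhammer_succ_eval,
    Nat.factorial_succ]
  push_cast
  field_simp
  ring

open Polynomial Finset in
theorem terminatingPoly_ode {b : ℝ} (hb : 0 < b) (k : ℕ) :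
    X * (1 - X) * derivative (derivative (terminatingPoly b k)) +
      (C b - C (b + 1) * X) * derivative (terminatingPoly b k) +
      C ((k : ℝ) * (k + b)) * terminatingPoly b k = 0 := by
  set F := terminatingPoly b k with hF
  have e : X * (1 - X) * derivative (derivative F) +
      (C b - C (b + 1) * X) * derivative F + C ((k : ℝ) * (k + b)) * F =
      X * derivative (derivative F) - X * (X * derivative (derivative F)) +
        (C b * derivative F - C (b + 1) * (X * derivative F)) + C ((k : ℝ) * (k + b)) * F := by
    ring
  rw [e]
  -- Coefficient by coefficient the equation is the two-term recurrence; `n = 0, 1` are separate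
  -- because multiplication by `X` shifts indices by up to two.
  ext n
  rcases n with _ | _ | n
  · have := terminatingCoeff_succ hb k 0
    simp only [coeff_add, coeff_sub, coeff_C_mul, coeff_X_mul_zero, coeff_derivative, hF,
      coeff_terminatingPoly, coeff_zero]
    push_cast at this ⊢
    linear_combination this
  · have := terminatingCoeff_succ hb k 1
    simp only [coeff_add, coeff_sub, coeff_C_mul, coeff_X_mul, coeff_X_mul_zero, coeff_derivative,
      hF, coeff_terminatingPoly, coeff_zero]
    push_cast at this ⊢
    linear_combination this
  · have := terminatingCoeff_succ hb k (n + 2)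
    simp only [coeff_add, coeff_sub, coeff_C_mul, coeff_X_mul, coeff_derivative, hF,
      coeff_terminatingPoly, coeff_zero]
    push_cast at this ⊢
    linear_combination this

open Polynomial Finset in
theorem eval_terminatingPoly_ode {b : ℝ} (hb : 0 < b) (k : ℕ) (x : ℝ) :
    x * (1 - x) * (derivative (derivative (terminatingPoly b k))).eval x +
      (b - (b + 1) * x) * (derivative (terminatingPoly b k)).eval x +
      k * (k + b) * (terminatingPoly b k).eval x = 0 := by
  have h := congrArg (eval x) (terminatingPoly_ode hb k)
  simpa using h

-- The second-order term vanishes at the singular point `x = 1`, which ties `F'(1)` to `F(1)`.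
open Polynomial Finset in
theorem eval_one_derivative_terminatingPoly {b : ℝ} (hb : 0 < b) (k : ℕ) :
    (derivative (terminatingPoly b k)).eval 1 = k * (k + b) * (terminatingPoly b k).eval 1 := by
  linear_combination -eval_terminatingPoly_ode hb k 1

open Polynomial Finset in
theorem eval_zero_terminatingPoly (b : ℝ) (k : ℕ) : (terminatingPoly b k).eval 0 = 1 := by
  rw [← ordinaryHypergeometric_neg_natCast, ordinaryHypergeometric_zero]

open Polynomial Finset in
theorem terminatingPoly_zero (b : ℝ) : terminatingPoly b 0 = 1 := by
  ext n
  rcases n with _ | n <;>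
  simp [terminatingPoly, terminatingCoeff]

/-- The Sonin function of `₂F₁(-k, b + k; b; x)`, scaled by `k (k + b)`. -/
noncomputable def soninPoly (b : ℝ) (k : ℕ) : Polynomial ℝ :=
  Polynomial.C ((k : ℝ) * (k + b)) * terminatingPoly b k ^ 2 +
    Polynomial.X * (1 - Polynomial.X) * Polynomial.derivative (terminatingPoly b k) ^ 2

-- Subtracting `2 F'` times the differential equation removes `F''` and `F`.
open Polynomial Finset in
theorem eval_derivative_soninPoly {b : ℝ} (hb : 0 < b) (k : ℕ) (x : ℝ) :
    (derivative (soninPoly b k)).eval x =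
      (2 * b * x - (2 * b - 1)) * (derivative (terminatingPoly b k)).eval x ^ 2 := by
  have h := eval_terminatingPoly_ode hb k x
  simp only [soninPoly, derivative_add, derivative_mul, derivative_C, derivative_X,
    derivative_pow, derivative_sub, derivative_one, eval_add, eval_mul, eval_C, eval_X, eval_pow,
    eval_sub, eval_one, eval_zero]
  push_cast
  simp only [pow_one]
  linear_combination 2 * (derivative (terminatingPoly b k)).eval x * h

-- The Sonin function decreases and then increases, so its maximum is at an endpoint: the value is
-- `k(k + b)` at `0` and `k(k + b) F(1)²` at `1`, with `|F(1)| ≤ 1`.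
open Polynomial Finset in
theorem eval_soninPoly_le {b : ℝ} (hb : 1 ≤ b) (k : ℕ) {x : ℝ} (h0 : 0 ≤ x) (h1 : x ≤ 1) :
    (soninPoly b k).eval x ≤ k * (k + b) := by
  have hb0 : 0 < b := by linarith
  -- The zero of the linear factor in the derivative.
  set m : ℝ := (2 * b - 1) / (2 * b) with hm
  have hm0 : 0 ≤ m := div_nonneg (by linarith) (by linarith)
  have hm1 : m ≤ 1 := (div_le_one (by linarith)).2 (by linarith)
  have hmb : 2 * b * m = 2 * b - 1 := by rw [hm]; field_simp
  have hk : (0 : ℝ) ≤ k * (k + b) := by positivity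
  rcases le_total x m with hx | hx
  · have hanti : AntitoneOn (fun y => (soninPoly b k).eval y) (Set.Icc 0 m) := by
      refine antitoneOn_of_deriv_nonpos (convex_Icc _ _) (soninPoly b k).continuousOn
        (soninPoly b k).differentiableOn fun y hy => ?_
      rw [interior_Icc] at hy
      rw [Polynomial.deriv, eval_derivative_soninPoly hb0]
      refine mul_nonpos_of_nonpos_of_nonneg ?_ (sq_nonneg _)
      nlinarith [hy.2]
    refine (hanti (Set.left_mem_Icc.2 hm0) ⟨h0, hx⟩ h0).trans_eq ?_
    simp [soninPoly, eval_zero_terminatingPoly]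
  · have hmono : MonotoneOn (fun y => (soninPoly b k).eval y) (Set.Icc m 1) := by
      refine monotoneOn_of_deriv_nonneg (convex_Icc _ _) (soninPoly b k).continuousOn
        (soninPoly b k).differentiableOn fun y hy => ?_
      rw [interior_Icc] at hy
      rw [Polynomial.deriv, eval_derivative_soninPoly hb0]
      refine mul_nonneg ?_ (sq_nonneg _)
      nlinarith [hy.1]
    refine (hmono ⟨hx, h1⟩ (Set.right_mem_Icc.2 hm1) h1).trans ?_
    have h := abs_terminatingEndpoint_le_one hb k
    rw [← sq_le_one_iff_abs_le_one] at h
    simp only [soninPoly, eval_add, eval_mul, eval_C, eval_pow, eval_X, eval_sub, eval_one,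
      sub_self, mul_zero, zero_mul, add_zero, eval_one_terminatingPoly hb0]
    exact mul_le_of_le_one_right hk h

open Polynomial Finset in
theorem abs_eval_terminatingPoly_le_one {b : ℝ} (hb : 1 ≤ b) (k : ℕ) {x : ℝ} (h0 : 0 ≤ x)
    (h1 : x ≤ 1) : |(terminatingPoly b k).eval x| ≤ 1 := by
  -- For `k = 0` the factor `k(k + b)` vanishes and cannot be cancelled.
  rcases Nat.eq_zero_or_pos k with rfl | hk
  · simp [terminatingPoly_zero]
  have h := eval_soninPoly_le hb k h0 h1
  have hk' : (0 : ℝ) < k * (k + b) := by positivity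
  rw [← sq_le_one_iff_abs_le_one]
  refine le_of_mul_le_mul_left ?_ hk'
  rw [mul_one]
  refine le_trans ?_ h
  have h2 : 0 ≤ x * (1 - x) := mul_nonneg h0 (by linarith)
  simp only [soninPoly, eval_add, eval_mul, eval_C, eval_pow, eval_X, eval_sub, eval_one]
  have := mul_nonneg h2 (sq_nonneg ((derivative (terminatingPoly b k)).eval x))
  linarith

/-! ### Moments, orthogonality and norms -/

/-- The linear functional `Q ↦ ∫₀¹ Q(r²) r ^ N dr` on polynomials. -/
noncomputable def radialIntegral (N : ℕ) : Polynomial ℝ →ₗ[ℝ] ℝ where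
  toFun Q := ∫ r in (0 : ℝ)..1, Q.eval (r ^ 2) * r ^ N
  map_add' P Q := by
    rw [← intervalIntegral.integral_add]
    · simp [add_mul]
    all_goals exact Continuous.intervalIntegrable (by fun_prop) _ _
  map_smul' a Q := by
    simp [mul_assoc]

open Polynomial Finset in
theorem radialIntegral_apply (N : ℕ) (Q : Polynomial ℝ) :
    radialIntegral N Q = ∫ r in (0 : ℝ)..1, Q.eval (r ^ 2) * r ^ N := rfl

open Polynomial Finset in
theorem radialIntegral_X_pow (N p : ℕ) :
    radialIntegral N (X ^ p) = 1 / (2 * p + (N + 1)) := by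
  rw [radialIntegral_apply]
  simp only [eval_pow, eval_X, ← pow_mul, ← pow_add, integral_pow]
  simp
  ring

-- Termwise integration gives `½ ∑ a_j / (b + p + j)`, the partial fraction sum at `s = b + p`.
open Polynomial Finset in
theorem radialIntegral_terminatingPoly_mul_X_pow {N : ℕ} {b : ℝ} (hN : 2 * b = N + 1) (k p : ℕ) :
    radialIntegral N (terminatingPoly b k * X ^ p) =
      terminatingEndpoint b k * (p.choose k * k.factorial) /
        (2 * (ascPochhammer ℝ (k + 1)).eval (b + p)) := by
  have hb : 0 < b := by
    have : (0 : ℝ) ≤ N := N.cast_nonneg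
    linarith
  have h := sum_terminatingCoeff_div hb (s := b + p) (by positivity) k
  have h2 : ∏ i ∈ range k, (b + p - b - i) = (p.choose k : ℝ) * k.factorial := by
    rw [mul_comm, ← Nat.cast_mul, ← Nat.descFactorial_eq_factorial_mul_choose,
      ← descPochhammer_eval_eq_descFactorial, descPochhammer_eval_eq_prod_range]
    exact prod_congr rfl fun _ _ => by ring
  rw [h2] at h
  rw [mul_comm (2 : ℝ), ← div_div, ← h, sum_div, terminatingPoly, sum_mul, map_sum]
  refine sum_congr rfl fun j _ => ?_
  rw [← C_mul_X_pow_eq_monomial, mul_assoc, ← pow_add, ← smul_eq_C_mul, map_smul,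
    radialIntegral_X_pow, ← hN, smul_eq_mul]
  have : 0 < b + p + j := by positivity
  have : 0 < 2 * (j + p : ℕ) + 2 * b := by positivity
  push_cast at this ⊢
  field_simp
  ring

-- Moments below order `k` vanish, so only the coefficient of `X ^ k` contributes. This yields both
-- orthogonality and the norm.
open Polynomial Finset in
theorem radialIntegral_terminatingPoly_mul {N : ℕ} {b : ℝ} (hN : 2 * b = N + 1) {k : ℕ}
    {Q : Polynomial ℝ} (hQ : Q.natDegree ≤ k) :
    radialIntegral N (terminatingPoly b k * Q) =
      Q.coeff k * radialIntegral N (terminatingPoly b k * X ^ k) := by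
  conv_lhs => rw [Q.as_sum_range_C_mul_X_pow' (Nat.lt_succ_of_le hQ)]
  rw [mul_sum, map_sum, sum_range_succ, sum_eq_zero, zero_add, mul_left_comm, ← smul_eq_C_mul,
    map_smul, smul_eq_mul]
  intro i hi
  rw [mul_left_comm, ← smul_eq_C_mul, map_smul, radialIntegral_terminatingPoly_mul_X_pow hN,
    Nat.choose_eq_zero_of_lt (mem_range.1 hi)]
  simp

open Polynomial Finset in
theorem natDegree_terminatingPoly_le (b : ℝ) (k : ℕ) : (terminatingPoly b k).natDegree ≤ k :=
  natDegree_le_iff_coeff_eq_zero.2 fun _ h => by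
    rw [coeff_terminatingPoly, terminatingCoeff_eq_zero h]

open Polynomial Finset in
theorem radialIntegral_terminatingPoly_mul_of_lt {N : ℕ} {b : ℝ} (hN : 2 * b = N + 1) {k j : ℕ}
    (h : j < k) : radialIntegral N (terminatingPoly b k * terminatingPoly b j) = 0 := by
  have hd := natDegree_terminatingPoly_le b j
  rw [radialIntegral_terminatingPoly_mul hN (hd.trans h.le), coeff_terminatingPoly,
    terminatingCoeff_eq_zero h, zero_mul]

open Polynomial Finset in
theorem radialIntegral_terminatingPoly_mul_of_ne {N : ℕ} {b : ℝ} (hN : 2 * b = N + 1) {k j : ℕ}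
    (h : k ≠ j) : radialIntegral N (terminatingPoly b k * terminatingPoly b j) = 0 := by
  rcases h.lt_or_gt with h | h
  · rw [mul_comm, radialIntegral_terminatingPoly_mul_of_lt hN h]
  · exact radialIntegral_terminatingPoly_mul_of_lt hN h

open Polynomial Finset in
theorem radialIntegral_terminatingPoly_mul_self {N : ℕ} {b : ℝ} (hN : 2 * b = N + 1) (k : ℕ) :
    radialIntegral N (terminatingPoly b k * terminatingPoly b k) =
      terminatingEndpoint b k ^ 2 / (2 * b + 4 * k) := by
  have hb : 0 < b := by
    have : (0 : ℝ) ≤ N := N.cast_nonneg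
    linarith
  rw [radialIntegral_terminatingPoly_mul hN (natDegree_terminatingPoly_le b k),
    coeff_terminatingPoly, terminatingCoeff_self hb,
    radialIntegral_terminatingPoly_mul_X_pow hN, ascPochhammer_succ_eval, Nat.choose_self]
  have h1 := ascPochhammer_pos k (b + k) (by positivity)
  have h2 : (k.factorial : ℝ) ≠ 0 := by positivity
  have h3 : 0 < b + k + k := by positivity
  have h4 : 0 < 2 * b + 4 * k := by positivity
  push_cast
  field_simp
  ring

/-! ### Expansion of monomials -/

-- The system is triangular with nonzero leading coefficients, so top terms can be removed
-- successively.
open Polynomial Finset in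
theorem exists_eq_sum_terminatingPoly {b : ℝ} (hb : 0 < b) (p : ℕ) :
    ∀ P : Polynomial ℝ, P.natDegree < p →
      ∃ e : ℕ → ℝ, P = ∑ k ∈ range p, C (e k) * terminatingPoly b k := by
  induction p with
  | zero => exact fun P h => absurd h (Nat.not_lt_zero _)
  | succ p ih =>
    intro P hP
    have ha : terminatingCoeff b p p ≠ 0 := by
      have h1 := ascPochhammer_pos p (b + p) (by positivity)
      rw [terminatingCoeff_self hb]
      exact div_ne_zero (mul_ne_zero (terminatingEndpoint_ne_zero hb p) h1.ne') (by positivity)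
    set a := P.coeff p / terminatingCoeff b p p with hadef
    set Q := P - C a * terminatingPoly b p with hQdef
    have hQ : ∀ n, p ≤ n → Q.coeff n = 0 := by
      intro n hn
      rw [hQdef, coeff_sub, coeff_C_mul, coeff_terminatingPoly]
      rcases hn.eq_or_lt with rfl | hn
      · rw [hadef, div_mul_cancel₀ _ ha, sub_self]
      · rw [terminatingCoeff_eq_zero hn, coeff_eq_zero_of_natDegree_lt (by omega)]
        simp
    have hP' : P = Q + C a * terminatingPoly b p := by rw [hQdef]; ring
    obtain ⟨e, he⟩ : ∃ e : ℕ → ℝ, Q = ∑ k ∈ range p, C (e k) * terminatingPoly b k := by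
      -- For `p = 0` the remainder is zero, yet its `natDegree` is not below `0`, so the induction
      -- hypothesis does not apply.
      rcases Nat.eq_zero_or_pos p with rfl | hp
      · refine ⟨0, ?_⟩
        ext n
        simp [hQ n (Nat.zero_le n)]
      · refine ih Q ?_
        have := natDegree_le_iff_coeff_eq_zero (n := p - 1).2 fun n hn => hQ n (by omega)
        omega
    refine ⟨fun k => if k = p then a else e k, ?_⟩
    rw [sum_range_succ, hP', he]
    simp only [if_true]
    congr 1
    exact sum_congr rfl fun k hk => by rw [if_neg (mem_range.1 hk).ne]

open Polynomial Finset in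
theorem X_pow_eq_sum_terminatingPoly {N : ℕ} {b : ℝ} (hN : 2 * b = N + 1) (p : ℕ) :
    (X ^ p : Polynomial ℝ) = ∑ k ∈ range (p + 1),
      C ((2 * b + 4 * k) * (p.choose k * k.factorial) /
        (terminatingEndpoint b k * (2 * (ascPochhammer ℝ (k + 1)).eval (b + p)))) *
          terminatingPoly b k := by
  have hb : 0 < b := by
    have : (0 : ℝ) ≤ N := N.cast_nonneg
    linarith
  obtain ⟨e, he⟩ := exists_eq_sum_terminatingPoly hb (p + 1) (X ^ p) (by simp)
  conv_lhs => rw [he]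
  refine sum_congr rfl fun k hk => ?_
  congr 2
  have h := radialIntegral_terminatingPoly_mul_X_pow hN k p
  -- Pairing with the `k`-th polynomial isolates `e k` as a moment divided by a squared norm.
  rw [he, mul_sum, map_sum, sum_eq_single k, mul_left_comm, ← smul_eq_C_mul, map_smul,
    radialIntegral_terminatingPoly_mul_self hN, smul_eq_mul] at h
  · have h1 := terminatingEndpoint_ne_zero hb k
    have h2 := ascPochhammer_pos (k + 1) (b + p) (by positivity)
    have h3 : 0 < 2 * b + 4 * k := by positivity
    field_simp at h ⊢
    linear_combination h
  · intro j _ hj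
    rw [mul_left_comm, ← smul_eq_C_mul, map_smul,
      radialIntegral_terminatingPoly_mul_of_ne hN hj.symm, smul_zero]
  · exact fun h => absurd hk h

/-! ### Radial Zernike functions: constants, endpoint values, bound, expansion -/

open Polynomial Finset in
theorem radialZernike_eq (d ℓ k : ℕ) (c r : ℝ) :
    radialZernike d ℓ k c r = c * r ^ ℓ * (terminatingPoly (ℓ + d / 2) k).eval (r ^ 2) := by
  rw [radialZernike, ← ordinaryHypergeometric_neg_natCast]
  congr 2
  ring

open Polynomial Finset in
theorem integral_radialZernike_mul (d ℓ k j : ℕ) (c c' : ℝ) :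
    ∫ r in (0 : ℝ)..1, radialZernike d ℓ k c r * radialZernike d ℓ j c' r * r ^ (d - 1) =
      c * c' * radialIntegral (2 * ℓ + (d - 1))
        (terminatingPoly (ℓ + d / 2) k * terminatingPoly (ℓ + d / 2) j) := by
  rw [radialIntegral_apply, ← intervalIntegral.integral_const_mul]
  congr 1
  ext r
  rw [radialZernike_eq, radialZernike_eq, eval_mul, pow_add, pow_mul']
  ring

theorem two_mul_radialParam {d : ℕ} (hd : 2 ≤ d) (ℓ : ℕ) :
    2 * ((ℓ : ℝ) + d / 2) = ((2 * ℓ + (d - 1) : ℕ) : ℝ) + 1 := by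
  push_cast [Nat.cast_sub (show 1 ≤ d by omega)]
  ring

theorem one_le_radialParam {d : ℕ} (hd : 2 ≤ d) (ℓ : ℕ) : 1 ≤ (ℓ : ℝ) + d / 2 := by
  have h1 : (2 : ℝ) ≤ d := by exact_mod_cast hd
  have h2 : (0 : ℝ) ≤ ℓ := ℓ.cast_nonneg
  linarith

theorem radialZernike_one {d : ℕ} (hd : 2 ≤ d) (ℓ k : ℕ) (c : ℝ) :
    radialZernike d ℓ k c 1 = c * terminatingEndpoint (ℓ + d / 2) k := by
  have hb := one_le_radialParam hd ℓ
  rw [radialZernike_eq, one_pow, one_pow, eval_one_terminatingPoly (by linarith), mul_one]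

/-- The squared norm of `F` is `F(1)² / (2b + 4k)`, so normalization prescribes exactly `R(1)²`; the
sign of `R(1)` then determines `c`. -/
theorem isNormalizing_iff {d : ℕ} (hd : 2 ≤ d) (ℓ k : ℕ) (c : ℝ) :
    IsNormalizing d ℓ k c ↔
      (c * terminatingEndpoint (ℓ + d / 2) k) ^ 2 = 2 * (ℓ : ℝ) + 4 * k + d := by
  have hb := one_le_radialParam hd ℓ
  have h : 0 < 2 * ((ℓ : ℝ) + d / 2) + 4 * k := by positivity
  simp only [IsNormalizing, pow_two (radialZernike _ _ _ _ _)]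
  rw [integral_radialZernike_mul, radialIntegral_terminatingPoly_mul_self (two_mul_radialParam hd ℓ),
    mul_div_assoc', div_eq_one_iff_eq h.ne']
  constructor <;> intro h <;> linear_combination h

open Polynomial in
theorem zernikeConst_mul_terminatingEndpoint {d : ℕ} (hd : 2 ≤ d) (ℓ k : ℕ) :
    zernikeConst d ℓ k * terminatingEndpoint (ℓ + d / 2) k = √(2 * (ℓ : ℝ) + 4 * k + d) := by
  have hb := one_le_radialParam hd ℓ
  have h1 := ascPochhammer_pos k ((ℓ : ℝ) + d / 2) (by linarith)
  have h2 : (k.factorial : ℝ) ≠ 0 := by positivity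
  have h3 : ((-1 : ℝ) ^ k) * (-1) ^ k = 1 := by rw [← mul_pow]; simp
  rw [zernikeConst, terminatingEndpoint,
    show (ℓ : ℝ) + k + ((d : ℝ) - 2) / 2 = (ℓ + d / 2 - 1) + k by ring,
    Ring.choose_eq_ascPochhammer_div, sub_add_cancel]
  generalize (ascPochhammer ℝ k).eval ((ℓ : ℝ) + d / 2) = A at *
  field_simp
  linear_combination h3

theorem eq_zernikeConst {d : ℕ} (hd : 2 ≤ d) {ℓ k : ℕ} {c : ℝ} (hc : IsNormalizing d ℓ k c)
    (hpos : 0 < radialZernike d ℓ k c 1) : c = zernikeConst d ℓ k := by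
  have hb := one_le_radialParam hd ℓ
  rw [radialZernike_one hd] at hpos
  refine mul_right_cancel₀ (terminatingEndpoint_ne_zero (b := (ℓ : ℝ) + d / 2) (by linarith) k) ?_
  rw [zernikeConst_mul_terminatingEndpoint hd, ← (isNormalizing_iff hd ℓ k c).1 hc,
    Real.sqrt_sq hpos.le]

theorem radialZernike_zernikeConst_one {d : ℕ} (hd : 2 ≤ d) (ℓ k : ℕ) :
    radialZernike d ℓ k (zernikeConst d ℓ k) 1 = √(2 * (ℓ : ℝ) + 4 * k + d) := by
  rw [radialZernike_one hd, zernikeConst_mul_terminatingEndpoint hd]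

theorem isNormalizing_zernikeConst {d : ℕ} (hd : 2 ≤ d) (ℓ k : ℕ) :
    IsNormalizing d ℓ k (zernikeConst d ℓ k) := by
  rw [isNormalizing_iff hd, zernikeConst_mul_terminatingEndpoint hd, Real.sq_sqrt (by positivity)]

open Polynomial in
theorem deriv_radialZernike_one {d : ℕ} (hd : 2 ≤ d) (ℓ k : ℕ) (c : ℝ) :
    deriv (radialZernike d ℓ k c) 1 =
      (ℓ + 2 * (k * (k + (ℓ + d / 2)))) * radialZernike d ℓ k c 1 := by
  have hb := one_le_radialParam hd ℓ
  have h1 : HasDerivAt (fun r : ℝ => (terminatingPoly ((ℓ : ℝ) + d / 2) k).eval (r ^ 2))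
      ((derivative (terminatingPoly ((ℓ : ℝ) + d / 2) k)).eval (1 ^ 2) * (2 * 1)) 1 := by
    refine HasDerivAt.comp (1 : ℝ) (Polynomial.hasDerivAt _ _) ?_
    simpa using hasDerivAt_pow 2 (1 : ℝ)
  have h2 := ((hasDerivAt_pow ℓ (1 : ℝ)).const_mul c).mul h1
  have h3 : radialZernike d ℓ k c = _ := funext (radialZernike_eq d ℓ k c)
  rw [h3]
  refine h2.deriv.trans ?_
  simp only [one_pow, eval_one_derivative_terminatingPoly (b := (ℓ : ℝ) + d / 2) (by linarith)]
  ring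

theorem abs_radialZernike_le {d : ℕ} (hd : 2 ≤ d) (ℓ k : ℕ) (c : ℝ) {r : ℝ} (h0 : 0 ≤ r)
    (h1 : r ≤ 1) : |radialZernike d ℓ k c r| ≤ |c| := by
  rw [radialZernike_eq, abs_mul, abs_mul, abs_of_nonneg (pow_nonneg h0 ℓ), mul_assoc]
  exact mul_le_of_le_one_right (abs_nonneg _) (mul_le_one₀ (pow_le_one₀ h0 h1) (abs_nonneg _)
    (abs_eval_terminatingPoly_le_one (one_le_radialParam hd ℓ) k (sq_nonneg r)
      (pow_le_one₀ h0 h1)))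

theorem continuous_radialZernike (d ℓ k : ℕ) (c : ℝ) : Continuous (radialZernike d ℓ k c) := by
  have h3 : radialZernike d ℓ k c = _ := funext (radialZernike_eq d ℓ k c)
  rw [h3]
  fun_prop

open Polynomial Finset in
theorem pow_eq_sum_radialZernike {d : ℕ} (hd : 2 ≤ d) (ℓ p : ℕ) (r : ℝ) :
    r ^ (ℓ + 2 * p) = ∑ k ∈ range (p + 1),
      zernikeChi d ℓ k p * radialZernike d ℓ k (zernikeConst d ℓ k) r := by
  have hb := one_le_radialParam hd ℓ
  have h := congrArg (eval (r ^ 2)) (X_pow_eq_sum_terminatingPoly (two_mul_radialParam hd ℓ) p)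
  rw [eval_pow, eval_X, ← pow_mul] at h
  rw [pow_add, h, eval_finsetSum, mul_sum]
  refine sum_congr rfl fun k _ => ?_
  have hz := zernikeConst_mul_terminatingEndpoint hd ℓ k
  have hs : √(2 * (ℓ : ℝ) + 4 * k + d) ^ 2 = 2 * (ℓ : ℝ) + 4 * k + d :=
    Real.sq_sqrt (by positivity)
  have hK := terminatingEndpoint_ne_zero (b := (ℓ : ℝ) + d / 2) (by linarith) k
  rw [← eq_div_iff hK] at hz
  have h1 := ascPochhammer_pos k ((ℓ : ℝ) + d / 2 + p) (by positivity)
  have h2 : (k.factorial : ℝ) ≠ 0 := by positivity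
  have h3 : 0 < (ℓ : ℝ) + d / 2 + p + k := by positivity
  have h4 : 0 < 2 * (p : ℝ) + 2 * ℓ + 2 * k + d := by
    rw [show 2 * (p : ℝ) + 2 * ℓ + 2 * k + d = 2 * ((ℓ : ℝ) + d / 2 + p + k) by ring]
    positivity
  rw [eval_mul, eval_C, radialZernike_eq, hz, zernikeChi, ascPochhammer_succ_eval,
    show (p : ℝ) + ℓ + k + ((d : ℝ) - 2) / 2 = (ℓ + d / 2 + p - 1) + k by ring,
    Ring.choose_eq_ascPochhammer_div, sub_add_cancel,
    show 2 * (p : ℝ) + 2 * ℓ + 2 * k + d = 2 * ((ℓ : ℝ) + d / 2 + p + k) by ring,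
    -- Of the two roots, one enters `zernikeChi` and the other `zernikeConst`.
    show 2 * ((ℓ : ℝ) + d / 2) + 4 * k = √(2 * (ℓ : ℝ) + 4 * k + d) ^ 2 by rw [hs]; ring]
  generalize √(2 * (ℓ : ℝ) + 4 * k + d) = S
  generalize (ℓ : ℝ) + d / 2 + p + k = T at *
  generalize (ascPochhammer ℝ k).eval ((ℓ : ℝ) + d / 2 + p) = A at *
  field_simp

/-! ### The weighted measure and completeness -/

theorem ae_mem_Icc_radialMeasure (d : ℕ) : ∀ᵐ r ∂radialMeasure d, r ∈ Set.Icc (0 : ℝ) 1 :=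
  (withDensity_absolutelyContinuous _ _).ae_le (ae_restrict_mem measurableSet_Icc)

theorem ae_ne_zero_radialMeasure (d : ℕ) : ∀ᵐ r ∂radialMeasure d, r ≠ 0 :=
  (withDensity_absolutelyContinuous _ _).ae_le
    (Measure.absolutelyContinuous_of_le Measure.restrict_le_self |>.ae_le (Measure.ae_ne volume 0))

theorem integral_radialMeasure {E : Type*} [NormedAddCommGroup E] [NormedSpace ℝ E] (d : ℕ)
    (f : ℝ → E) : ∫ r, f r ∂radialMeasure d = ∫ r in (0 : ℝ)..1, r ^ (d - 1) • f r := by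
  rw [radialMeasure, integral_withDensity_eq_integral_toReal_smul (by fun_prop)
    (Filter.Eventually.of_forall fun _ => ENNReal.ofReal_lt_top),
    intervalIntegral.integral_of_le zero_le_one, ← integral_Icc_eq_integral_Ioc]
  refine setIntegral_congr_fun measurableSet_Icc fun r hr => ?_
  simp only [ENNReal.toReal_ofReal (pow_nonneg hr.1 _)]

instance isFiniteMeasure_radialMeasure (d : ℕ) : IsFiniteMeasure (radialMeasure d) := by
  refine isFiniteMeasure_withDensity_ofReal ?_
  refine Integrable.hasFiniteIntegral ?_
  exact (continuous_pow (d - 1)).continuousOn.integrableOn_Icc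

theorem memLp_radialZernike {d : ℕ} (hd : 2 ≤ d) (ℓ k : ℕ) (c : ℝ) :
    MemLp (fun r => (radialZernike d ℓ k c r : ℂ)) 2 (radialMeasure d) := by
  refine MemLp.of_bound (C := |c|) (Continuous.aestronglyMeasurable
    (Complex.continuous_ofReal.comp (continuous_radialZernike d ℓ k c))) ?_
  filter_upwards [ae_mem_Icc_radialMeasure d] with r hr
  rw [Complex.norm_real]
  exact abs_radialZernike_le hd ℓ k c hr.1 hr.2

theorem integral_radialZernike_mul_radialMeasure {d : ℕ} (hd : 2 ≤ d) {ℓ : ℕ} {C : ℕ → ℝ}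
    (hC : ∀ k, IsNormalizing d ℓ k (C k)) (i j : ℕ) :
    ∫ r, radialZernike d ℓ i (C i) r * radialZernike d ℓ j (C j) r ∂radialMeasure d =
      if i = j then 1 else 0 := by
  rw [integral_radialMeasure]
  simp only [smul_eq_mul, mul_comm (_ ^ (d - 1))]
  split_ifs with h
  · subst h
    simpa only [IsNormalizing, pow_two] using hC i
  · rw [integral_radialZernike_mul,
      radialIntegral_terminatingPoly_mul_of_ne (two_mul_radialParam hd ℓ) h, mul_zero]

open Polynomial in
/-- An integrable function on `[0, 1]` all of whose even moments vanish is almost everywhere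
zero. -/
theorem ae_eq_zero_of_forall_integral_even_pow {μ : Measure ℝ} [IsFiniteMeasure μ]
    (hμ : ∀ᵐ r ∂μ, r ∈ Set.Icc (0 : ℝ) 1) {h : ℝ → ℂ} (hh : Integrable h μ)
    (hmom : ∀ p : ℕ, ∫ r, ((r : ℂ) ^ (2 * p)) * h r ∂μ = 0) : ∀ᵐ r ∂μ, h r = 0 := by
  have hint : ∀ P : ℝ[X], Integrable (fun r => P.eval (r ^ 2) • h r) μ := by
    intro P
    obtain ⟨B, hB⟩ := isCompact_Icc.exists_bound_of_continuousOn (s := Set.Icc (0 : ℝ) 1)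
      (f := fun r : ℝ => P.eval (r ^ 2)) (by fun_prop)
    have hc : Continuous fun r : ℝ => P.eval (r ^ 2) := by fun_prop
    refine hh.bdd_smul B hc.aestronglyMeasurable ?_
    filter_upwards [hμ] with r hr using hB r hr
  have hpoly : ∀ P : ℝ[X], ∫ r, P.eval (r ^ 2) • h r ∂μ = 0 := by
    intro P
    induction P using Polynomial.induction_on' with
    | add P Q hP hQ =>
      simp only [eval_add, add_smul]
      rw [integral_add (hint P) (hint Q), hP, hQ, add_zero]
    | monomial n a =>
      have h2 := hmom n
      simp only [eval_monomial, mul_smul]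
      rw [integral_smul]
      simp only [Complex.real_smul, ← pow_mul, Complex.ofReal_pow]
      rw [h2, mul_zero]
  -- It suffices to test against smooth compactly supported `g`.
  refine ae_eq_zero_of_integral_contDiff_smul_eq_zero hh.locallyIntegrable fun g hg _ => ?_
  have hgc : Continuous g := hg.continuous
  have hbound : ∀ ε > 0, ‖∫ r, g r • h r ∂μ‖ ≤ ε * ∫ r, ‖h r‖ ∂μ := by
    intro ε hε
    -- Approximating `x ↦ g √x` and substituting `x = r ^ 2` approximates `g` on `[0, 1]` by even
    -- polynomials, as `√(r ^ 2) = r` there.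
    obtain ⟨P, hP⟩ := exists_polynomial_near_of_continuousOn 0 1 (fun x => g √x)
      (by fun_prop) ε hε
    have hgP : ∀ᵐ r ∂μ, ‖g r - P.eval (r ^ 2)‖ ≤ ε := by
      filter_upwards [hμ] with r hr
      have := hP (r ^ 2) ⟨sq_nonneg r, pow_le_one₀ hr.1 hr.2⟩
      rw [Real.sqrt_sq hr.1, abs_sub_comm] at this
      exact this.le
    have hdiff : Integrable (fun r => (g r - P.eval (r ^ 2)) • h r) μ :=
      hh.bdd_smul ε (Continuous.aestronglyMeasurable (by fun_prop)) hgP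
    have heq : ∫ r, g r • h r ∂μ = ∫ r, (g r - P.eval (r ^ 2)) • h r ∂μ := by
      rw [← add_zero (∫ r, (g r - P.eval (r ^ 2)) • h r ∂μ), ← hpoly P,
        ← integral_add hdiff (hint P)]
      simp only [← add_smul, sub_add_cancel]
    rw [heq, ← integral_const_mul]
    refine norm_integral_le_of_norm_le (hh.norm.const_mul ε) ?_
    filter_upwards [hgP] with r hr
    rw [norm_smul]
    exact mul_le_mul_of_nonneg_right hr (norm_nonneg _)
  refine norm_le_zero_iff.1 (le_of_forall_pos_le_add fun δ hδ => ?_)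
  have hI : 0 ≤ ∫ r, ‖h r‖ ∂μ := integral_nonneg fun _ => norm_nonneg _
  -- The `+ 1` keeps the denominator positive when `h` has zero norm.
  refine (hbound (δ / (∫ r, ‖h r‖ ∂μ + 1)) (by positivity)).trans ?_
  rw [zero_add, div_mul_eq_mul_div, div_le_iff₀ (by positivity)]
  nlinarith

theorem radialZernike_eq_div_mul (d ℓ k : ℕ) {c : ℝ} (hc : c ≠ 0) (c' r : ℝ) :
    radialZernike d ℓ k c' r = c' / c * radialZernike d ℓ k c r := by
  rw [radialZernike_eq, radialZernike_eq]
  field_simp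

theorem IsNormalizing.ne_zero {d ℓ k : ℕ} {c : ℝ} (hc : IsNormalizing d ℓ k c) : c ≠ 0 := by
  rintro rfl
  simp [IsNormalizing, radialZernike] at hc

/-- The monomials `r ^ (ℓ + 2p)` are combinations of the `R_{ℓ,k}`, so all even moments of `r ^ ℓ f`
vanish. -/
theorem ae_eq_zero_of_forall_integral_radialZernike {d : ℕ} (hd : 2 ≤ d) {ℓ : ℕ} {C : ℕ → ℝ}
    (hC : ∀ k, IsNormalizing d ℓ k (C k)) {f : ℝ → ℂ} (hf : Integrable f (radialMeasure d))
    (h : ∀ k, ∫ r, (radialZernike d ℓ k (C k) r : ℂ) * f r ∂radialMeasure d = 0) :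
    f =ᵐ[radialMeasure d] 0 := by
  have hint : ∀ g : ℝ → ℝ, Continuous g →
      Integrable (fun r => (g r : ℂ) * f r) (radialMeasure d) := by
    intro g hg
    obtain ⟨B, hB⟩ := isCompact_Icc.exists_bound_of_continuousOn (s := Set.Icc (0 : ℝ) 1)
      hg.continuousOn
    refine hf.bdd_mul (c := B) (Continuous.aestronglyMeasurable (by fun_prop)) ?_
    filter_upwards [ae_mem_Icc_radialMeasure d] with r hr
    rw [Complex.norm_real]
    exact hB r hr
  -- The expansion uses the positive sign choice; rescaling by a constant reaches it from an
  -- arbitrary one.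
  have h' : ∀ k, ∫ r, (radialZernike d ℓ k (zernikeConst d ℓ k) r : ℂ) * f r ∂radialMeasure d
      = 0 := by
    intro k
    simp only [radialZernike_eq_div_mul d ℓ k (hC k).ne_zero (zernikeConst d ℓ k),
      Complex.ofReal_mul, mul_assoc]
    rw [integral_const_mul, h k, mul_zero]
  have hmom : ∀ p : ℕ, ∫ r, ((r : ℂ) ^ (2 * p)) * ((r : ℂ) ^ ℓ * f r) ∂radialMeasure d = 0 := by
    intro p
    have e : ∀ r : ℝ, ((r : ℂ) ^ (2 * p)) * ((r : ℂ) ^ ℓ * f r) =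
        ∑ k ∈ Finset.range (p + 1), (zernikeChi d ℓ k p : ℂ) *
          ((radialZernike d ℓ k (zernikeConst d ℓ k) r : ℂ) * f r) := by
      intro r
      have := congrArg (fun x : ℝ => (x : ℂ)) (pow_eq_sum_radialZernike hd ℓ p r)
      push_cast at this
      rw [← mul_assoc, ← pow_add, add_comm, this, Finset.sum_mul]
      simp only [mul_assoc]
    simp only [e]
    rw [integral_finsetSum]
    · simp only [integral_const_mul, h', mul_zero, Finset.sum_const_zero]
    · exact fun k _ => (hint _ (continuous_radialZernike d ℓ k _)).const_mul _
  have h0 := ae_eq_zero_of_forall_integral_even_pow (ae_mem_Icc_radialMeasure d)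
    (h := fun r : ℝ => (r : ℂ) ^ ℓ * f r)
    (by simpa using hint (fun r => r ^ ℓ) (continuous_pow ℓ)) hmom
  -- Division by `r ^ ℓ` fails at most at the null point `r = 0`.
  filter_upwards [h0, ae_ne_zero_radialMeasure d] with r hr hr0
  exact (mul_eq_zero.1 hr).resolve_left (pow_ne_zero _ (Complex.ofReal_ne_zero.2 hr0))

theorem isRadialOrthonormalBasis_radialZernike {d : ℕ} (hd : 2 ≤ d) {ℓ : ℕ} {C : ℕ → ℝ}
    (hC : ∀ k, IsNormalizing d ℓ k (C k)) :
    IsRadialOrthonormalBasis d fun k => radialZernike d ℓ k (C k) := by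
  have hmem := fun k => memLp_radialZernike hd ℓ k (C k)
  let v : ℕ → Lp ℂ 2 (radialMeasure d) := fun k => (hmem k).toLp _
  have hv : ∀ k, (v k : ℝ → ℂ) =ᵐ[radialMeasure d] fun r => (radialZernike d ℓ k (C k) r : ℂ) :=
    fun k => (hmem k).coeFn_toLp
  have hinner : ∀ k (f : Lp ℂ 2 (radialMeasure d)), inner ℂ (v k) f =
      ∫ r, (radialZernike d ℓ k (C k) r : ℂ) * f r ∂radialMeasure d := by
    intro k f
    rw [L2.inner_def]
    refine integral_congr_ae ?_
    filter_upwards [hv k] with r hr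
    rw [hr, RCLike.inner_apply, Complex.conj_ofReal, mul_comm]
  have horth : Orthonormal ℂ v := by
    rw [orthonormal_iff_ite]
    intro i j
    have e : ∫ r, (radialZernike d ℓ i (C i) r : ℂ) * v j r ∂radialMeasure d =
        ∫ r, ((radialZernike d ℓ i (C i) r * radialZernike d ℓ j (C j) r : ℝ) : ℂ)
          ∂radialMeasure d := by
      refine integral_congr_ae ?_
      filter_upwards [hv j] with r hr
      rw [hr, Complex.ofReal_mul]
    rw [hinner, e, integral_complex_ofReal, integral_radialZernike_mul_radialMeasure hd hC]
    split_ifs <;> simp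
  have hbot : (Submodule.span ℂ (Set.range v))ᗮ = ⊥ := by
    rw [Submodule.eq_bot_iff]
    intro f hf
    rw [Submodule.mem_orthogonal] at hf
    rw [Lp.eq_zero_iff_ae_eq_zero]
    refine ae_eq_zero_of_forall_integral_radialZernike hd hC
      ((Lp.memLp f).integrable one_le_two) fun k => ?_
    rw [← hinner]
    exact hf _ (Submodule.subset_span ⟨k, rfl⟩)
  refine ⟨HilbertBasis.mkOfOrthogonalEqBot horth hbot, fun k => ?_⟩
  rw [HilbertBasis.coe_mkOfOrthogonalEqBot]
  exact hv k

theorem mainTheorem3 (d : ℕ) (hd : 2 ≤ d) :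
    -- normalization constants with the positive sign choice exist
    (∃ C : ℕ → ℕ → ℝ, ∀ ℓ k, IsNormalizing d ℓ k (C ℓ k) ∧ 0 < radialZernike d ℓ k (C ℓ k) 1) ∧
    -- for every choice of normalization constants:
    ∀ C : ℕ → ℕ → ℝ, (∀ ℓ k, IsNormalizing d ℓ k (C ℓ k)) →
      -- (i)
      (∀ ℓ, IsRadialOrthonormalBasis d (fun k => radialZernike d ℓ k (C ℓ k))) ∧
      -- (ii)
      (∀ ℓ k, 0 < radialZernike d ℓ k (C ℓ k) 1 →
        C ℓ k = zernikeConst d ℓ k ∧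
        radialZernike d ℓ k (C ℓ k) 1 = √(2 * (ℓ : ℝ) + 4 * k + d)) ∧
      -- (iii)
      (∀ ℓ k, 0 < radialZernike d ℓ k (C ℓ k) 1 → ¬(ℓ = 0 ∧ k = 0) →
        0 < deriv (radialZernike d ℓ k (C ℓ k)) 1) ∧
      (∃ a : ℝ, ∀ r : ℝ, radialZernike d 0 0 (C 0 0) r = a) ∧
      -- (iv)
      (∀ ℓ k, ∃ M : ℝ,
        IsGreatest ((fun r => |radialZernike d ℓ k (C ℓ k) r|) '' Set.Icc (0 : ℝ) 1) M ∧
        M ≤ |C ℓ k|) ∧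
      -- (v)
      (∀ ℓ p, (∀ k ≤ p, 0 < radialZernike d ℓ k (C ℓ k) 1) → ∀ r : ℝ,
        r ^ (ℓ + 2 * p) =
          ∑ k ∈ Finset.range (p + 1),
            zernikeChi d ℓ k p * radialZernike d ℓ k (C ℓ k) r) := by
  refine ⟨⟨zernikeConst d, fun ℓ k => ⟨isNormalizing_zernikeConst hd ℓ k, ?_⟩⟩, fun C hC =>
    ⟨fun ℓ => isRadialOrthonormalBasis_radialZernike hd (hC ℓ), fun ℓ k hpos => ?_,
      fun ℓ k hpos hne => ?_, ⟨C 0 0, fun r => ?_⟩, fun ℓ k => ?_, fun ℓ p hpos r => ?_⟩⟩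
  · rw [radialZernike_zernikeConst_one hd]
    positivity
  · have h := eq_zernikeConst hd (hC ℓ k) hpos
    exact ⟨h, by rw [h, radialZernike_zernikeConst_one hd]⟩
  · rw [deriv_radialZernike_one hd]
    refine mul_pos ?_ hpos
    rcases Nat.eq_zero_or_pos ℓ with rfl | hℓ
    · have hk : 0 < k := Nat.pos_of_ne_zero fun h => hne ⟨rfl, h⟩
      positivity
    · positivity
  · simp [radialZernike_eq, terminatingPoly_zero]
  · obtain ⟨x, hx, hmax⟩ := isCompact_Icc.exists_isMaxOn (Set.nonempty_Icc.2 zero_le_one)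
      (continuous_radialZernike d ℓ k (C ℓ k)).abs.continuousOn
    refine ⟨_, ⟨⟨x, hx, rfl⟩, ?_⟩, abs_radialZernike_le hd ℓ k _ hx.1 hx.2⟩
    rintro _ ⟨y, hy, rfl⟩
    exact hmax hy
  · rw [pow_eq_sum_radialZernike hd]
    refine Finset.sum_congr rfl fun k hk => ?_
    rw [eq_zernikeConst hd (hC ℓ k) (hpos k (Nat.lt_succ_iff.1 (Finset.mem_range.1 hk)))]
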